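/- Let $\gamma_x,\gamma_y$ be independent random variables, not necessarily identically distributed, where for $i\in\{x,y\}$ the variable $\gamma_i$ has the Fisher–Snedecor $\mathcal F$ distribution with parameters $m_i>0$, $m_{s_i}>1$, $\bar\gamma_i>0$, i.e. the density $$f_{\gamma_i}(t)=\frac{m_i^{m_i}(m_{s_i}-1)^{m_{s_i}}\,\bar\gamma_i^{\,m_{s_i}}\,t^{m_i-1}}{B(m_i,m_{s_i})\,\bigl(m_i t+(m_{s_i}-1)\bar\gamma_i\bigr)^{m_i+m_{s_i}}}\quad(t>0),\qquad f_{\gamma_i}(t)=0\quad(t\le 0).$$ Put $\Lambda_i=\dfrac{m_i}{(m_{s_i}-1)\bar\gamma_i}$, $\Theta_i=\dfrac1{\Gamma(m_i)\Gamma(m_{s_i})}$, $B(a,b)=\Gamma(a)\Gamma(b)/\Gamma(a+b)$ and $\gamma_z=\min\{\gamma_x,\gamma_y\}$. Let $G^{m,n}_{p,q}$ denote the Meijer G-function (Mellin–Barnes integral) and ${}_2F_1$ the Gauss hypergeometric function, continued analytically to $\mathbb C\setminus[1,\infty)$. Write $$G_{2,i}(t)=G^{1,2}_{2,2}\!\left[t\,\middle|\begin{matrix}1-m_{s_i},\,1\\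 m_i,\,0\end{matrix}\right],\qquad G_{3,i}(t)=G^{1,3}_{3,3}\!\left[t\,\middle|\begin{matrix}-1,\,-m_{s_i},\,0\\ m_i-1,\,0,\,-1\end{matrix}\right].$$ 1. (CDF) The cumulative distribution function of $\gamma_z$ satisfies $F_{\gamma_z}(u)=0$ for $u\le0$ and, for every $u>0$, $$F_{\gamma_z}(u)=\sum_{i\in\{x,y\}}\Theta_i\,G_{2,i}(\Lambda_i u)-\prod_{i\in\{x,y\}}\Theta_i\,G_{2,i}(\Lambda_i u).$$ 2. (PDF) $\gamma_z$ has a probability density $f_{\gamma_z}\ge 0$ which vanishes on $(-\infty,0]$ and such that, for every $z>0$, $F_{\gamma_z}$ is differentiable at $z$ with $F_{\gamma_z}'(z)=f_{\gamma_z}(z)$, $$f_{\gamma_z}(z)=\sum_{i\in\{x,y\}}\Lambda_i\Theta_i\,G_{3,i}(\Lambda_i z)-\sum_{\substack{i,l\in\{x,y\}\\ i\ne l}}\Lambda_l\Theta_l\,G_{3,l}(\Lambda_l z)\;\Theta_i\,G_{2,i}(\Lambda_i z),$$ and also $$f_{\gamma_z}(z)=\sum_{i\in\{x,y\}}\frac{\Lambda_i^{m_i}z^{m_i-1}(1+\Lambda_i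 z)^{-(m_i+m_{s_i})}}{B(m_i,m_{s_i})}-\sum_{\substack{i,l\in\{x,y\}\\ i\ne l}}\frac{\Lambda_l^{m_l}z^{m_l-1}(1+\Lambda_l z)^{-(m_l+m_{s_l})}}{B(m_l,m_{s_l})}\cdot\frac{\Lambda_i^{m_i}z^{m_i}}{m_i\,B(m_i,m_{s_i})}\;{}_2F_1\bigl(m_i,\,m_i+m_{s_i};\,m_i+1;\,-\Lambda_i z\bigr).$$ -/

import Mathlib

open MeasureTheory ProbabilityTheory

/-! ### The Gauss hypergeometric function -/

/-- The complex plane cut along `[1, ∞)`. -/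
def gaussCutPlane : Set ℂ := {z : ℂ | 1 - z ∈ Complex.slitPlane}

/-- `g` is the holomorphic continuation to `ℂ ∖ [1, ∞)` of the Gauss hypergeometric series
`∑ (a)ₙ (b)ₙ / ((c)ₙ n!) zⁿ`, `|z| < 1`. -/
def IsGaussContinuation (a b c : ℂ) (g : ℂ → ℂ) : Prop :=
  DifferentiableOn ℂ g gaussCutPlane ∧
    ∀ z : ℂ, ‖z‖ < 1 → g z = ordinaryHypergeometric a b c z

/-- The continuation to the cut plane is unique. -/
theorem IsGaussContinuation.eqOn {a b c : ℂ} {g h : ℂ → ℂ}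
    (hg : IsGaussContinuation a b c g) (hh : IsGaussContinuation a b c h) :
    Set.EqOn g h gaussCutPlane := by
  have hopen : IsOpen gaussCutPlane :=
    Complex.isOpen_slitPlane.preimage (continuous_const.sub continuous_id)
  have himg : gaussCutPlane = (fun w : ℂ => 1 - w) '' Complex.slitPlane := by
    ext z
    constructor
    · intro hz
      exact ⟨1 - z, hz, by ring⟩
    · rintro ⟨w, hw, rfl⟩
      simpa [gaussCutPlane] using hw
  have hslit : IsPreconnected Complex.slitPlane :=
    (Complex.starConvex_one_slitPlane.isPathConnected
      Complex.one_mem_slitPlane).isConnected.isPreconnected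
  have hconn : IsPreconnected gaussCutPlane := by
    rw [himg]
    exact hslit.image _ (by fun_prop)
  have h0 : (0 : ℂ) ∈ gaussCutPlane := by simp [gaussCutPlane]
  refine (hg.1.analyticOnNhd hopen).eqOn_of_preconnected_of_eventuallyEq
    (hh.1.analyticOnNhd hopen) hconn h0 ?_
  filter_upwards [Metric.ball_mem_nhds (0 : ℂ) one_pos] with z hz
  have hz' : ‖z‖ < 1 := by simpa using hz
  rw [hg.2 z hz', hh.2 z hz']

open Classical in
/-- The Gauss hypergeometric function `₂F₁(a, b; c; z)` on `ℂ ∖ [1, ∞)` (principal branch):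
the holomorphic continuation of the hypergeometric series. Mathlib's `ordinaryHypergeometric` is
the sum of the series only, hence `0` for `|z| > 1` when the series diverges there. -/
noncomputable def gaussHypergeometric (a b c z : ℂ) : ℂ :=
  if h : ∃ g : ℂ → ℂ, IsGaussContinuation a b c g then h.choose z else 0

/-! ### The Meijer G-function -/

/-- The integrand of the Mellin–Barnes integral of `G^{m,n}_{p,q}[z | a; b]`,
`∏_{j ≤ m} Γ(b_j - s) ∏_{j ≤ n} Γ(1 - a_j + s)
  / (∏_{j > m} Γ(1 - b_j + s) ∏_{j > n} Γ(a_j - s)) * z ^ s`. The indices of `a` and `b` start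
at `0` here. -/
noncomputable def meijerIntegrand (m n : ℕ) {p q : ℕ} (a : Fin p → ℂ) (b : Fin q → ℂ)
    (z s : ℂ) : ℂ :=
  (∏ j : Fin q, if (j : ℕ) < m then Complex.Gamma (b j - s)
      else (Complex.Gamma (1 - b j + s))⁻¹) *
    (∏ j : Fin p, if (j : ℕ) < n then Complex.Gamma (1 - a j + s)
      else (Complex.Gamma (a j - s))⁻¹) * z ^ s

/-- The line `Re s = c` separates the poles `b_j + k` of the `Γ(b_j - s)`, `j ≤ m` (to its right)
from the poles `a_j - 1 - k` of the `Γ(1 - a_j + s)`, `j ≤ n` (to its left). -/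
def MeijerSeparates (m n : ℕ) {p q : ℕ} (a : Fin p → ℂ) (b : Fin q → ℂ) (c : ℝ) : Prop :=
  (∀ j : Fin q, (j : ℕ) < m → ∀ k : ℕ, c < (b j + k).re) ∧
    (∀ j : Fin p, (j : ℕ) < n → ∀ k : ℕ, (a j - 1 - k).re < c)

open Classical in
/-- The Meijer G-function `G^{m,n}_{p,q}[z | a; b] = (2πi)⁻¹ ∫_L (integrand) ds`, where the contour
`L` runs from `-i∞` to `i∞` and separates the two families of poles. `L` is a vertical line
`s = c + i t`, `ds = i dt`, which is possible for all parameters with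
`Re a_j - 1 < Re b_k`, `j ≤ n`, `k ≤ m`; by Cauchy's theorem the choice of the line is
immaterial. -/
noncomputable def meijerG (m n : ℕ) {p q : ℕ} (a : Fin p → ℂ) (b : Fin q → ℂ) (z : ℂ) : ℂ :=
  if h : ∃ c : ℝ, MeijerSeparates m n a b c then
    (2 * (Real.pi : ℂ))⁻¹ * ∫ t : ℝ, meijerIntegrand m n a b z ((h.choose : ℂ) + Complex.I * t)
  else 0

/-! ### The Fisher–Snedecor F distribution -/

/-- The density of the Fisher–Snedecor `F` fading distribution with multipath severity `m`,
shadowing parameter `ms` and mean power `γ`. -/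
noncomputable def fisherSnedecorPDF (m ms γ x : ℝ) : ℝ :=
  if 0 < x then
    m ^ m * (ms - 1) ^ ms * γ ^ ms * x ^ (m - 1) /
      (beta m ms * (m * x + (ms - 1) * γ) ^ (m + ms))
  else 0

/-- The Fisher–Snedecor `F` fading distribution. -/
noncomputable def fisherSnedecor (m ms γ : ℝ) : Measure ℝ :=
  volume.withDensity fun x => ENNReal.ofReal (fisherSnedecorPDF m ms γ x)

/-- The scale `Λ = m / ((ms - 1) γ)`. -/
noncomputable def fsScale (m ms γ : ℝ) : ℝ := m / ((ms - 1) * γ)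

/-- The constant `Θ = 1 / (Γ(m) Γ(ms))`. -/
noncomputable def fsTheta (m ms : ℝ) : ℝ := 1 / (Real.Gamma m * Real.Gamma ms)

/-- `G^{1,2}_{2,2}[z | 1 - ms, 1; m, 0]`. -/
noncomputable def fsG22 (m ms : ℝ) (z : ℂ) : ℂ :=
  meijerG 1 2 ![1 - (ms : ℂ), 1] ![(m : ℂ), 0] z

/-- `G^{1,3}_{3,3}[z | -1, -ms, 0; m - 1, 0, -1]`. -/
noncomputable def fsG33 (m ms : ℝ) (z : ℂ) : ℂ :=
  meijerG 1 3 ![-1, -(ms : ℂ), 0] ![(m : ℂ) - 1, 0, -1] z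

/-! ### The Mellin transform of `(1 + x) ^ (-a)` -/

/-! With `n = ms`, rescaling by `Λ` turns each Fisher–Snedecor law into the beta prime law with
density `x^(m-1) (1+x)^(-(m+n)) / B(m,n)`. Everything then rests on one Mellin pair: `Γ(m+n) x^m
(1+x)^(-(m+n))` is the Mellin–Barnes integral of `Γ(m-s) Γ(n+s) x^s`
(`integral_Gamma_sub_mul_Gamma_add_mul_cpow`), by Euler's beta integral and Mellin inversion.

In `fsG33` the Gamma factors cancel to `Γ(m-1-s) Γ(1+n+s)`, the same integrand with `s` shifted by
one, which gives the density. In `fsG22` the extra factor is `Γ(s)/Γ(1+s) = 1/s`; since `x^s/s = ∫₀ˣ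
y^(s-1) dy`, Fubini gives the primitive of the density. Euler's integral for `₂F₁(a,b;a+1;·)`,
holomorphic on the cut plane, expresses the same primitive by `gaussHypergeometric`.

For the minimum, independence gives `1 - F_Z = (1 - F_X)(1 - F_Y)`; differentiating on `(0,∞)` gives
the density `f(1-G) + g(1-F)`, with `F`, `G` the primitives of `f`, `g` (`cdf_and_density_of_min`).
-/

theorem cpow_ofReal_eq_exp {p : ℝ} (hp : 0 < p) (s : ℂ) :
    (p : ℂ) ^ s = Complex.exp (Real.log p * s) := by
  rw [Complex.cpow_def_of_ne_zero (by exact_mod_cast hp.ne'), Complex.ofReal_log hp.le]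

theorem image_div_one_sub_Ioo :
    (fun t : ℝ => t / (1 - t)) '' Set.Ioo 0 1 = Set.Ioi 0 := by
  ext x
  constructor
  · rintro ⟨t, ⟨h0, h1⟩, rfl⟩
    exact div_pos h0 (by linarith)
  · intro hx
    have hx : 0 < x := hx
    refine ⟨x / (1 + x), ⟨by positivity, (div_lt_one (by linarith)).2 (by linarith)⟩, ?_⟩
    field_simp
    ring

theorem injOn_div_one_sub_Ioo : Set.InjOn (fun t : ℝ => t / (1 - t)) (Set.Ioo 0 1) := by
  rintro s ⟨_, hs⟩ t ⟨_, ht⟩ h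
  have hs' : 1 - s ≠ 0 := by linarith
  have ht' : 1 - t ≠ 0 := by linarith
  simp only at h
  rw [div_eq_div_iff hs' ht'] at h
  linarith

theorem hasDerivWithinAt_div_one_sub {t : ℝ} (ht : t ∈ Set.Ioo (0 : ℝ) 1) :
    HasDerivWithinAt (fun t : ℝ => t / (1 - t)) (((1 - t) ^ 2)⁻¹) (Set.Ioo 0 1) t := by
  have h : 1 - t ≠ 0 := by linarith [ht.2]
  refine (((hasDerivAt_id' t).div ((hasDerivAt_id' t).const_sub 1) h).congr_deriv
    ?_).hasDerivWithinAt
  field_simp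
  ring

/-- All bases are positive reals, so only exponents need comparing: the Jacobian contributes `-2` to
the power of `1 - t`, the other factors `1 - s` and `a`. -/
theorem betaPrime_integrand_comp {a s : ℂ} {t : ℝ} (ht : t ∈ Set.Ioo (0 : ℝ) 1) :
    |((1 - t) ^ 2)⁻¹| • (((t / (1 - t) : ℝ) : ℂ) ^ (s - 1) •
      (((1 + t / (1 - t) : ℝ) : ℂ) ^ (-a))) =
      (t : ℂ) ^ (s - 1) * (1 - (t : ℂ)) ^ (a - s - 1) := by
  obtain ⟨h0, h1⟩ := ht
  have h1' : 0 < 1 - t := by linarith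
  have e1 : 1 + t / (1 - t) = (1 - t)⁻¹ := by field_simp; ring
  have e2 : (((1 - t) ^ 2)⁻¹ : ℝ) = Real.exp (-2 * Real.log (1 - t)) := by
    rw [neg_mul, Real.exp_neg, mul_comm, ← Real.rpow_def_of_pos h1',
      Real.rpow_two]
  rw [abs_of_pos (by positivity), e1, e2, cpow_ofReal_eq_exp (by positivity),
    cpow_ofReal_eq_exp (by positivity), cpow_ofReal_eq_exp h0,
    show (1 - (t : ℂ)) = ((1 - t : ℝ) : ℂ) by push_cast; rfl, cpow_ofReal_eq_exp h1',
    Real.log_div h0.ne' h1'.ne', Real.log_inv, Complex.real_smul, smul_eq_mul,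
    Complex.ofReal_exp, ← Complex.exp_add, ← Complex.exp_add, ← Complex.exp_add]
  congr 1
  push_cast
  ring

theorem mellinConvergent_one_add_cpow {a s : ℂ} (hs : 0 < s.re) (hsa : s.re < a.re) :
    MellinConvergent (fun x : ℝ => ((1 + x : ℝ) : ℂ) ^ (-a)) s := by
  rw [MellinConvergent, ← image_div_one_sub_Ioo,
    integrableOn_image_iff_integrableOn_abs_deriv_smul measurableSet_Ioo
      (fun t ht => hasDerivWithinAt_div_one_sub ht) injOn_div_one_sub_Ioo,
    integrableOn_congr_fun (fun t ht => betaPrime_integrand_comp ht) measurableSet_Ioo,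
    ← integrableOn_Ioc_iff_integrableOn_Ioo,
    ← intervalIntegrable_iff_integrableOn_Ioc_of_le zero_le_one]
  exact Complex.betaIntegral_convergent hs (by simpa using hsa)

/-- The substitution `x = t/(1-t)` turns the integral into the beta integral `B(s, a-s)`. -/
theorem mellin_one_add_cpow {a s : ℂ} (hs : 0 < s.re) (hsa : s.re < a.re) :
    mellin (fun x : ℝ => ((1 + x : ℝ) : ℂ) ^ (-a)) s =
      Complex.Gamma s * Complex.Gamma (a - s) / Complex.Gamma a := by
  have ha : Complex.Gamma a ≠ 0 := Complex.Gamma_ne_zero_of_re_pos (hs.trans hsa)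
  rw [mellin, ← image_div_one_sub_Ioo,
    integral_image_eq_integral_abs_deriv_smul measurableSet_Ioo
      (fun t ht => hasDerivWithinAt_div_one_sub ht) injOn_div_one_sub_Ioo,
    setIntegral_congr_fun measurableSet_Ioo (fun t ht => betaPrime_integrand_comp ht),
    ← integral_Ioc_eq_integral_Ioo, ← intervalIntegral.integral_of_le zero_le_one,
    Complex.Gamma_mul_Gamma_eq_betaIntegral hs (by simpa using hsa), add_sub_cancel,
    mul_div_cancel_left₀ _ ha, Complex.betaIntegral]

/-! ### Integrability of products of Gamma functions along vertical lines -/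

theorem norm_Gamma_le_Gamma_re {s : ℂ} (hs : 0 < s.re) :
    ‖Complex.Gamma s‖ ≤ Real.Gamma s.re := by
  rw [Complex.Gamma_eq_integral hs, Real.Gamma_eq_integral hs, Complex.GammaIntegral]
  refine (norm_integral_le_integral_norm _).trans_eq
    (setIntegral_congr_fun measurableSet_Ioi fun x hx => ?_)
  simp only [norm_mul, Complex.norm_real, Real.norm_eq_abs, Real.abs_exp]
  rw [Complex.norm_cpow_eq_rpow_re_of_pos hx]
  simp

theorem min_sq_mul_one_add_sq_le_norm_sq {σ y : ℝ} (hσ : 0 < σ) :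
    min σ 1 ^ 2 * (1 + y ^ 2) ≤ ‖(σ + y * Complex.I : ℂ)‖ ^ 2 := by
  have h : ‖(σ + y * Complex.I : ℂ)‖ ^ 2 = σ ^ 2 + y ^ 2 := by
    rw [← Complex.normSq_eq_norm_sq, Complex.normSq_add_mul_I]
  rw [h]
  have h1 : min σ 1 ^ 2 ≤ σ ^ 2 := pow_le_pow_left₀ (by positivity) (min_le_left _ _) 2
  have h2 : min σ 1 ^ 2 ≤ 1 := pow_le_one₀ (by positivity) (min_le_right _ _)
  nlinarith [sq_nonneg y]

/-- One use of `Γ(s+1) = s Γ(s)`, with `|Γ(s+1)| ≤ Γ(σ+1)`, already gives decay of order `1/|y|`. A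
product of two such factors is then integrable, so Stirling's formula is not needed. -/
theorem norm_Gamma_sq_mul_le {σ y : ℝ} (hσ : 0 < σ) :
    ‖Complex.Gamma (σ + y * Complex.I)‖ ^ 2 * (1 + y ^ 2) ≤
      (Real.Gamma (σ + 1) / min σ 1) ^ 2 := by
  have hmin : 0 < min σ 1 := by positivity
  have hne : (σ + y * Complex.I : ℂ) ≠ 0 := fun h => by
    have := congrArg Complex.re h
    simp at this
    exact hσ.ne' this
  have h1 := norm_Gamma_le_Gamma_re (s := σ + y * Complex.I + 1) (by simp; linarith)
  rw [Complex.Gamma_add_one _ hne, norm_mul] at h1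
  have h1 : ‖(σ + y * Complex.I : ℂ)‖ * ‖Complex.Gamma (σ + y * Complex.I)‖ ≤
    Real.Gamma (σ + 1) := by simpa using h1
  have h2 := min_sq_mul_one_add_sq_le_norm_sq (y := y) hσ
  rw [div_pow, le_div_iff₀ (by positivity)]
  calc _ = ‖Complex.Gamma (σ + y * Complex.I)‖ ^ 2 * (min σ 1 ^ 2 * (1 + y ^ 2)) := by ring
    _ ≤ ‖Complex.Gamma (σ + y * Complex.I)‖ ^ 2 * ‖(σ + y * Complex.I : ℂ)‖ ^ 2 := by gcongr
    _ = (‖(σ + y * Complex.I : ℂ)‖ * ‖Complex.Gamma (σ + y * Complex.I)‖) ^ 2 := by ring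
    _ ≤ _ := by gcongr

theorem continuous_Gamma_vertical {σ : ℝ} (hσ : 0 < σ) :
    Continuous fun y : ℝ => Complex.Gamma (σ + y * Complex.I) := by
  refine continuous_iff_continuousAt.2 fun y => ?_
  refine ContinuousAt.comp (f := fun y : ℝ => (σ + y * Complex.I : ℂ)) ?_ (by fun_prop)
  refine (Complex.differentiableAt_Gamma _ fun n h => ?_).continuousAt
  have := congrArg Complex.re h
  simp at this
  have hn : (0 : ℝ) ≤ n := n.cast_nonneg
  linarith

theorem integrable_Gamma_mul_Gamma {σ τ : ℝ} (hσ : 0 < σ) (hτ : 0 < τ) :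
    Integrable fun y : ℝ =>
      Complex.Gamma (σ + y * Complex.I) * Complex.Gamma (τ - y * Complex.I) := by
  have hcont : Continuous fun y : ℝ => Complex.Gamma (τ - y * Complex.I) := by
    have := (continuous_Gamma_vertical hτ).comp continuous_neg
    refine this.congr fun y => ?_
    simp [sub_eq_add_neg]
  set A := Real.Gamma (σ + 1) / min σ 1
  set B := Real.Gamma (τ + 1) / min τ 1
  refine Integrable.mono' (integrable_inv_one_add_sq.const_mul (A ^ 2 + B ^ 2))
    ((continuous_Gamma_vertical hσ).mul hcont).aestronglyMeasurable (ae_of_all _ fun y => ?_)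
  have h1 := norm_Gamma_sq_mul_le (y := y) hσ
  have h2 := norm_Gamma_sq_mul_le (y := -y) hτ
  rw [norm_mul, ← div_eq_mul_inv, le_div_iff₀ (by positivity)]
  push_cast at h2
  rw [neg_mul, ← sub_eq_add_neg, neg_sq] at h2
  have hy : 0 < 1 + y ^ 2 := by positivity
  -- AM-GM: the product of the norms is at most the sum of their squares.
  nlinarith [sq_nonneg (‖Complex.Gamma (σ + y * Complex.I)‖ -
    ‖Complex.Gamma (τ - y * Complex.I)‖)]

/-! ### The Mellin–Barnes integral of `x ^ m * (1 + x) ^ (-(m + n))` -/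

theorem integrable_Gamma_sub_mul_Gamma_add {m n c : ℝ} (hc : c < m) (hc' : -n < c) :
    Integrable fun t : ℝ =>
      Complex.Gamma (m - (c + Complex.I * t)) * Complex.Gamma (n + (c + Complex.I * t)) := by
  have := (integrable_Gamma_mul_Gamma (σ := m - c) (τ := n + c) (by linarith)
    (by linarith)).comp_neg
  refine this.congr (ae_of_all _ fun t => ?_)
  push_cast
  congr 2 <;> ring

theorem integral_Gamma_sub_mul_Gamma_add_mul_cpow {m n c x : ℝ} (hc : c < m) (hc' : -n < c)
    (hx : 0 < x) :
    (2 * (Real.pi : ℂ))⁻¹ * ∫ t : ℝ, Complex.Gamma (m - (c + Complex.I * t)) *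
        Complex.Gamma (n + (c + Complex.I * t)) * (x : ℂ) ^ (c + Complex.I * t : ℂ) =
      ((Real.Gamma (m + n) * (x ^ m * (1 + x) ^ (-(m + n))) : ℝ) : ℂ) := by
  set a : ℝ := m + n with ha
  set h : ℝ → ℂ := fun x => ((1 + x : ℝ) : ℂ) ^ (-(a : ℂ)) with hh
  have hx1 : 0 < 1 + x := by linarith
  have ha0 : 0 < a := by linarith
  have hΓ : Complex.Gamma a ≠ 0 := Complex.Gamma_ne_zero_of_re_pos (by simpa using ha0)
  have hmel : ∀ y : ℝ, mellin h ((m - c : ℝ) + y * Complex.I) =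
      Complex.Gamma ((m - c : ℝ) + y * Complex.I) *
        Complex.Gamma ((n + c : ℝ) - y * Complex.I) / Complex.Gamma a := fun y => by
    rw [hh, mellin_one_add_cpow (by simp; linarith) (by simp; linarith)]
    congr 3
    push_cast [ha]
    ring
  have hvert : Complex.VerticalIntegrable (mellin h) (m - c : ℝ) := by
    refine ((integrable_Gamma_mul_Gamma (σ := m - c) (τ := n + c) (by linarith)
      (by linarith)).div_const (Complex.Gamma a)).congr (ae_of_all _ fun y => ?_)
    simp only [hmel]
  have hcont : ContinuousAt h x := by
    refine ContinuousAt.comp (g := fun z : ℂ => z ^ (-(a : ℂ)))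
      (f := fun x : ℝ => ((1 + x : ℝ) : ℂ)) ?_ (by fun_prop)
    exact continuousAt_cpow_const (Complex.ofReal_mem_slitPlane.2 hx1)
  -- The inversion is applied on `Re = m - c`, because `s ↦ m - s` exchanges it with the line `Re s
  -- = c`; the reflection `t ↦ -t` below restores the orientation.
  have key := mellinInv_mellin_eq (m - c : ℝ) h hx
    (mellinConvergent_one_add_cpow (by simp; linarith) (by simp; linarith)) hvert hcont
  rw [mellinInv, ← integral_neg_eq_self] at key
  simp_rw [hmel] at key
  have hcast : ((Real.Gamma a * (x ^ m * (1 + x) ^ (-a)) : ℝ) : ℂ) =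
      Complex.Gamma a * (x : ℂ) ^ (m : ℂ) * h x := by
    rw [hh, Complex.Gamma_ofReal]
    push_cast [Complex.ofReal_cpow hx.le, Complex.ofReal_cpow hx1.le]
    ring
  rw [hcast, ← key, Complex.real_smul, mul_left_comm,
    ← integral_const_mul (Complex.Gamma a * (x : ℂ) ^ (m : ℂ))]
  congr 1
  · push_cast; rw [one_div]
  refine integral_congr_ae (ae_of_all _ fun t => ?_)
  have hx0 : (x : ℂ) ≠ 0 := by exact_mod_cast hx.ne'
  have e : (x : ℂ) ^ (c + Complex.I * t : ℂ) = (x : ℂ) ^ (m : ℂ) *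
      (x : ℂ) ^ (-(((m - c : ℝ) : ℂ) + ((-t : ℝ) : ℂ) * Complex.I)) := by
    rw [← Complex.cpow_add _ _ hx0]
    congr 1
    push_cast
    ring
  simp only [e, smul_eq_mul]
  rw [show (((m - c : ℝ) : ℂ) + ((-t : ℝ) : ℂ) * Complex.I) = m - (c + Complex.I * t) by
    push_cast; ring, show (((n + c : ℝ) : ℂ) - ((-t : ℝ) : ℂ) * Complex.I) =
    n + (c + Complex.I * t) by push_cast; ring]
  field_simp

/-! ### The two Meijer G-functions -/

theorem integral_Gamma_sub_mul_Gamma_add_div_mul_cpow {m n c x : ℝ} (hc : c < m) (hc0 : 0 < c)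
    (hn : 0 < n) (hx : 0 < x) :
    (2 * (Real.pi : ℂ))⁻¹ * ∫ t : ℝ, Complex.Gamma (m - (c + Complex.I * t)) *
        Complex.Gamma (n + (c + Complex.I * t)) *
        ((x : ℂ) ^ (c + Complex.I * t : ℂ) / (c + Complex.I * t)) =
      ((∫ y in (0 : ℝ)..x, Real.Gamma (m + n) * (y ^ (m - 1) * (1 + y) ^ (-(m + n))) : ℝ) : ℂ) := by
  set G : ℝ → ℂ := fun t => Complex.Gamma (m - (c + Complex.I * t)) *
    Complex.Gamma (n + (c + Complex.I * t)) with hG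
  have hGint : Integrable G := integrable_Gamma_sub_mul_Gamma_add hc (by linarith)
  have hpow : ∀ t : ℝ, (x : ℂ) ^ (c + Complex.I * t : ℂ) / (c + Complex.I * t) =
      ∫ y in (0 : ℝ)..x, (y : ℂ) ^ (c + Complex.I * t - 1 : ℂ) := fun t => by
    have h0 : (c + Complex.I * t : ℂ) ≠ 0 := fun h => by
      have := congrArg Complex.re h
      simp at this
      exact hc0.ne' this
    rw [integral_cpow (Or.inl (by simpa using hc0))]
    simp [h0]
  -- On the line, `|y^(s-1)| = y^(c-1)` does not depend on `t`, so the Fubini majorant is a product;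
  -- `c > 0` makes it integrable at `y = 0`.
  have hbound : Integrable (fun p : ℝ × ℝ => p.1 ^ (c - 1) * ‖G p.2‖)
      ((volume.restrict (Set.uIoc 0 x)).prod volume) := by
    have h : IntervalIntegrable (fun y : ℝ => y ^ (c - 1)) volume 0 x :=
      intervalIntegral.intervalIntegrable_rpow' (by linarith)
    exact Integrable.mul_prod (intervalIntegrable_iff.1 h) hGint.norm
  have hint : Integrable (Function.uncurry fun (y t : ℝ) =>
      G t * (y : ℂ) ^ (c + Complex.I * t - 1 : ℂ))
      ((volume.restrict (Set.uIoc 0 x)).prod volume) := by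
    refine hbound.mono' ?_ ?_
    · refine (hGint.1.comp_snd (μ := volume.restrict (Set.uIoc 0 x))).mul ?_
      exact Measurable.aestronglyMeasurable (by fun_prop)
    · rw [← Measure.restrict_univ (μ := (volume : Measure ℝ)), Measure.restrict_restrict
        measurableSet_uIoc, Measure.prod_restrict]
      refine ae_restrict_of_forall_mem (by measurability) ?_
      rintro ⟨y, t⟩ ⟨hy, -⟩
      have hy : 0 < y := by
        have := hy.1
        rw [Set.uIoc_of_le hx.le] at this
        exact this.1
      simp only [Function.uncurry, norm_mul, Complex.norm_cpow_eq_rpow_re_of_pos hy]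
      simp [mul_comm]
  simp_rw [hpow, ← intervalIntegral.integral_const_mul]
  rw [← intervalIntegral_integral_swap hint, ← intervalIntegral.integral_const_mul,
    ← intervalIntegral.integral_ofReal]
  refine intervalIntegral.integral_congr_ae (ae_of_all _ fun y hy => ?_)
  rw [Set.uIoc_of_le hx.le] at hy
  have hy0 : (y : ℂ) ≠ 0 := by exact_mod_cast hy.1.ne'
  have key := integral_Gamma_sub_mul_Gamma_add_mul_cpow (n := n) hc (by linarith) hy.1
  have e : y ^ (m - 1) = y ^ m / y := Real.rpow_sub_one hy.1.ne' m
  have e' : ((Real.Gamma (m + n) * (y ^ (m - 1) * (1 + y) ^ (-(m + n))) : ℝ) : ℂ) =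
      ((Real.Gamma (m + n) * (y ^ m * (1 + y) ^ (-(m + n))) : ℝ) : ℂ) / y := by
    rw [e]
    push_cast
    ring
  rw [e', ← key, mul_div_assoc, ← integral_div]
  congr 1
  refine integral_congr_ae (ae_of_all _ fun t => ?_)
  simp only [hG]
  rw [Complex.cpow_sub _ _ hy0, Complex.cpow_one, mul_div_assoc]

/-- The density of the standard beta prime distribution on the positive half-line. -/
noncomputable def betaPrimePDF (m n x : ℝ) : ℝ := x ^ (m - 1) * (1 + x) ^ (-(m + n)) / beta m n

theorem fsTheta_mul_Gamma (m n : ℝ) : fsTheta m n * Real.Gamma (m + n) = (beta m n)⁻¹ := by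
  rw [fsTheta, beta, inv_div, one_div_mul_eq_div]

theorem fsTheta_mul_fsG22 {m n x : ℝ} (hm : 0 < m) (hn : 0 < n) (hx : 0 < x) :
    (fsTheta m n : ℂ) * fsG22 m n x = ((∫ y in (0 : ℝ)..x, betaPrimePDF m n y : ℝ) : ℂ) := by
  have hex : ∃ c : ℝ, MeijerSeparates 1 2 ![1 - (n : ℂ), 1] ![(m : ℂ), 0] c := by
    refine ⟨m / 2, ?_, ?_⟩
    · intro j hj k
      have hk : (0 : ℝ) ≤ k := k.cast_nonneg
      fin_cases j
      · simp; linarith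
      · simp at hj
    · intro j hj k
      have hk : (0 : ℝ) ≤ k := k.cast_nonneg
      fin_cases j <;> simp <;> linarith
  rw [fsG22, meijerG, dif_pos hex]
  -- The abscissa in `meijerG` is an arbitrary choice; the first poles of `Γ(m-s)` and `Γ(s)` give
  -- `0 < c < m`, which is all that is used.
  obtain ⟨h1, h2⟩ := hex.choose_spec
  set c := hex.choose
  have hcm : c < m := by simpa using h1 0 (by simp) 0
  have hc0 : 0 < c := by simpa using h2 1 (by simp) 0
  have hpdf : ∀ y, betaPrimePDF m n y =
      fsTheta m n * (Real.Gamma (m + n) * (y ^ (m - 1) * (1 + y) ^ (-(m + n)))) := fun y => by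
    rw [← mul_assoc, fsTheta_mul_Gamma, betaPrimePDF, div_eq_inv_mul]
  simp_rw [hpdf]
  rw [intervalIntegral.integral_const_mul, Complex.ofReal_mul,
    ← integral_Gamma_sub_mul_Gamma_add_div_mul_cpow hcm hc0 hn hx]
  congr 2
  refine integral_congr_ae (ae_of_all _ fun t => ?_)
  have h0 : (c + Complex.I * t : ℂ) ≠ 0 := fun h => by
    have := congrArg Complex.re h
    simp at this
    exact hc0.ne' this
  have hΓ : Complex.Gamma (c + Complex.I * t) ≠ 0 :=
    Complex.Gamma_ne_zero_of_re_pos (by simpa using hc0)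
  simp only [meijerIntegrand, Fin.prod_univ_two]
  simp
  rw [add_comm 1 (c + Complex.I * t : ℂ), Complex.Gamma_add_one _ h0]
  field_simp

theorem fsTheta_mul_fsG33 {m n x : ℝ} (hm : 0 < m) (hn : 0 < n) (hx : 0 < x) :
    (fsTheta m n : ℂ) * fsG33 m n x = (betaPrimePDF m n x : ℂ) := by
  have hex : ∃ c : ℝ, MeijerSeparates 1 3 ![-1, -(n : ℂ), 0] ![(m : ℂ) - 1, 0, -1] c := by
    refine ⟨m / 2 - 1, ?_, ?_⟩
    · intro j hj k
      have hk : (0 : ℝ) ≤ k := k.cast_nonneg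
      fin_cases j
      · simp; linarith
      · simp at hj
      · simp at hj
    · intro j hj k
      have hk : (0 : ℝ) ≤ k := k.cast_nonneg
      fin_cases j <;> simp <;> linarith
  rw [fsG33, meijerG, dif_pos hex]
  obtain ⟨h1, h2⟩ := hex.choose_spec
  set c := hex.choose
  have hcm : c < m - 1 := by simpa using h1 0 (by simp) 0
  have hc0 : -1 < c := by simpa using h2 2 (by simp) 0
  have hx0 : (x : ℂ) ≠ 0 := by exact_mod_cast hx.ne'
  -- The shift `s ↦ s + 1` moves the contour abscissa to `c + 1` and costs a factor `x`, hence the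
  -- division by `x` in `hpdf`.
  have key := integral_Gamma_sub_mul_Gamma_add_mul_cpow (m := m) (n := n) (c := c + 1)
    (by linarith) (by linarith) hx
  have hpdf : (betaPrimePDF m n x : ℂ) = fsTheta m n *
      (((Real.Gamma (m + n) * (x ^ m * (1 + x) ^ (-(m + n))) : ℝ) : ℂ) / x) := by
    rw [← Complex.ofReal_div, ← Complex.ofReal_mul, betaPrimePDF, Real.rpow_sub_one hx.ne',
      div_eq_inv_mul, ← fsTheta_mul_Gamma]
    congr 1
    ring
  rw [hpdf, ← key, mul_div_assoc, ← integral_div]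
  congr 2
  refine integral_congr_ae (ae_of_all _ fun t => ?_)
  have hΓ1 : Complex.Gamma (1 + (c + Complex.I * t)) ≠ 0 :=
    Complex.Gamma_ne_zero_of_re_pos (by simp; linarith)
  have hΓ2 : Complex.Gamma (1 + 1 + (c + Complex.I * t)) ≠ 0 :=
    Complex.Gamma_ne_zero_of_re_pos (by simp; linarith)
  simp only [meijerIntegrand, Fin.prod_univ_three]
  simp
  have e : ((x : ℂ) ^ (c + 1 + Complex.I * t : ℂ)) = x ^ (c + Complex.I * t : ℂ) * x := by
    rw [show (c + 1 + Complex.I * t : ℂ) = (c + Complex.I * t) + 1 by ring,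
      Complex.cpow_add _ _ hx0, Complex.cpow_one]
  rw [e, show (m - (c + 1 + Complex.I * t) : ℂ) = m - 1 - (c + Complex.I * t) by ring,
    show (n + (c + 1 + Complex.I * t) : ℂ) = 1 + n + (c + Complex.I * t) by ring]
  field_simp

/-! ### Euler's integral for the Gauss hypergeometric function with `c = a + 1` -/

/-- The slit plane is star-shaped about `1`, and `1 - w t` runs along the segment from `1` to `1 -
w`. -/
theorem one_sub_mul_mem_slitPlane {w : ℂ} (hw : w ∈ gaussCutPlane) {t : ℝ}
    (ht : t ∈ Set.Icc (0 : ℝ) 1) : 1 - w * t ∈ Complex.slitPlane := by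
  have := Complex.starConvex_one_slitPlane.add_smul_sub_mem hw ht.1 ht.2
  convert this using 1
  rw [Complex.real_smul]
  ring

theorem isOpen_gaussCutPlane : IsOpen gaussCutPlane :=
  Complex.isOpen_slitPlane.preimage (continuous_const.sub continuous_id)

/-- Both sides are `(a)ₙ₊₁`. It turns the moment `1/(a+n)` into the ratio `(a)ₙ/(a+1)ₙ` of the
hypergeometric series. -/
theorem ascPochhammer_eval_mul_add (a : ℂ) (n : ℕ) :
    (ascPochhammer ℂ n).eval a * (a + n) = a * (ascPochhammer ℂ n).eval (a + 1) := by
  rw [← ascPochhammer_succ_eval, ascPochhammer_succ_left, Polynomial.eval_mul, Polynomial.eval_X,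
    Polynomial.eval_comp]
  simp

theorem choose_add_sub_one_eq_ascPochhammer (b : ℂ) (n : ℕ) :
    Ring.choose (b + n - 1) n = (n.factorial : ℂ)⁻¹ * (ascPochhammer ℂ n).eval b := by
  have h := Ring.factorial_nsmul_multichoose_eq_ascPochhammer b n
  rw [Polynomial.ascPochhammer_smeval_eq_eval, nsmul_eq_mul] at h
  have h0 : (n.factorial : ℂ) ≠ 0 := by exact_mod_cast n.factorial_ne_zero
  rw [← Ring.multichoose_eq, ← h, inv_mul_cancel_left₀ h0]

theorem hasSum_one_sub_cpow_neg (b : ℂ) {w : ℂ} (hw : ‖w‖ < 1) :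
    HasSum (fun n : ℕ => Ring.choose (b + n - 1) n * w ^ n) ((1 - w) ^ (-b)) := by
  have := (Complex.one_div_one_sub_cpow_hasFPowerSeriesOnBall_zero b).hasSum (y := w)
    (by simpa [enorm_eq_nnnorm, ← NNReal.coe_lt_coe] using hw)
  simp only [FormalMultilinearSeries.ofScalars_apply_eq, zero_add, smul_eq_mul] at this
  rwa [Complex.cpow_neg, ← one_div]

theorem summable_norm_choose_mul_pow (b : ℂ) {w : ℂ} (hw : ‖w‖ < 1) :
    Summable fun n : ℕ => ‖Ring.choose (b + n - 1) n * w ^ n‖ := by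
  have h := Complex.one_div_one_sub_cpow_hasFPowerSeriesOnBall_zero b
  have := FormalMultilinearSeries.summable_norm_apply _ (x := w)
    (Metric.eball_subset_eball h.r_le (by simpa [enorm_eq_nnnorm, ← NNReal.coe_lt_coe] using hw))
  simpa only [FormalMultilinearSeries.ofScalars_apply_eq, smul_eq_mul] using this

/-- Euler's integral for `₂F₁(a, b; a + 1; w)`. -/
noncomputable def eulerIntegral (a : ℝ) (b w : ℂ) : ℂ :=
  a * ∫ t in (0 : ℝ)..1, ((t ^ (a - 1) : ℝ) : ℂ) * (1 - w * t) ^ (-b)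

theorem integral_rpow_mul_pow {a : ℝ} (ha : 0 < a) (n : ℕ) :
    ∫ t in (0 : ℝ)..1, t ^ (a - 1) * t ^ n = 1 / (a + n) := by
  have hn : (0 : ℝ) ≤ n := n.cast_nonneg
  have : ∫ t in (0 : ℝ)..1, t ^ (a - 1) * t ^ n = ∫ t in (0 : ℝ)..1, t ^ (a - 1 + n) := by
    refine intervalIntegral.integral_congr_ae (ae_of_all _ fun t ht => ?_)
    rw [Set.uIoc_of_le zero_le_one] at ht
    rw [Real.rpow_add ht.1, Real.rpow_natCast]
  rw [this, integral_rpow (Or.inl (by linarith)), Real.one_rpow,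
    Real.zero_rpow (by linarith), sub_zero]
  congr 1
  ring

/-- Expand `(1 - w t)^(-b)` binomially and integrate term by term; `|w t| ≤ |w| < 1` gives a
majorant of the series, uniform in `t` up to the factor `t^(a-1)`. -/
theorem eulerIntegral_eq_ordinaryHypergeometric {a : ℝ} (ha : 0 < a) (b : ℂ) {w : ℂ}
    (hw : ‖w‖ < 1) : eulerIntegral a b w = ordinaryHypergeometric (a : ℂ) b (a + 1 : ℂ) w := by
  have hI : IntervalIntegrable (fun t : ℝ => t ^ (a - 1)) volume 0 1 :=
    intervalIntegral.intervalIntegrable_rpow' (by linarith)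
  have hsum := intervalIntegral.hasSum_integral_of_dominated_convergence
    (μ := volume) (a := 0) (b := 1)
    (F := fun (n : ℕ) (t : ℝ) => ((t ^ (a - 1) : ℝ) : ℂ) *
      (Ring.choose (b + n - 1) n * (w * t) ^ n))
    (f := fun t : ℝ => ((t ^ (a - 1) : ℝ) : ℂ) * (1 - w * t) ^ (-b))
    (fun n t => t ^ (a - 1) * ‖Ring.choose (b + n - 1) n * w ^ n‖)
    (fun n => Measurable.aestronglyMeasurable (by fun_prop))
    (fun n => ae_of_all _ fun t ht => ?_)
    (ae_of_all _ fun t _ => (summable_norm_choose_mul_pow b hw).mul_left _)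
    (by simp_rw [tsum_mul_left]; exact hI.mul_const _)
    (ae_of_all _ fun t ht => HasSum.mul_left _ (hasSum_one_sub_cpow_neg b ?_))
  · rw [eulerIntegral, ← hsum.tsum_eq, ordinaryHypergeometric_eq_tsum, ← tsum_mul_left]
    refine tsum_congr fun n => ?_
    have hterm : ∫ t in (0 : ℝ)..1, ((t ^ (a - 1) : ℝ) : ℂ) *
        (Ring.choose (b + n - 1) n * (w * t) ^ n) =
        (Ring.choose (b + n - 1) n * w ^ n) * ((1 / (a + n) : ℝ) : ℂ) := by
      rw [← integral_rpow_mul_pow ha, ← intervalIntegral.integral_ofReal,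
        ← intervalIntegral.integral_const_mul]
      congr 1
      ext t
      push_cast
      ring
    have hn : (0 : ℝ) ≤ n := n.cast_nonneg
    have h1 : (a + n : ℂ) ≠ 0 := by exact_mod_cast (by linarith : a + n ≠ 0)
    have h2 : (ascPochhammer ℂ n).eval (a + 1 : ℂ) ≠ 0 := by
      rw [Ne, ascPochhammer_eval_eq_zero_iff]
      rintro ⟨k, -, hk⟩
      have := congrArg Complex.re hk
      simp at this
      have hk : (0 : ℝ) ≤ k := k.cast_nonneg
      linarith
    rw [hterm, choose_add_sub_one_eq_ascPochhammer, smul_eq_mul]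
    have h3 := ascPochhammer_eval_mul_add a n
    push_cast
    field_simp
    linear_combination (-(n.factorial : ℂ)⁻¹ * (ascPochhammer ℂ n).eval b * w ^ n) * h3
  · rw [Set.uIoc_of_le zero_le_one] at ht
    have ht0 : 0 ≤ t ^ (a - 1) := Real.rpow_nonneg ht.1.le _
    rw [mul_pow, ← mul_assoc (Ring.choose _ _), norm_mul, norm_mul _ ((t : ℂ) ^ n),
      Complex.norm_real, Real.norm_of_nonneg ht0]
    refine mul_le_mul_of_nonneg_left (mul_le_of_le_one_right (norm_nonneg _) ?_) ht0
    rw [norm_pow, Complex.norm_real, Real.norm_of_nonneg ht.1.le]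
    exact pow_le_one₀ ht.1.le ht.2
  · rw [Set.uIoc_of_le zero_le_one] at ht
    rw [norm_mul, Complex.norm_real, Real.norm_of_nonneg ht.1.le]
    exact (mul_le_of_le_one_right (norm_nonneg _) ht.2).trans_lt hw

theorem differentiableOn_eulerIntegral {a : ℝ} (ha : 0 < a) (b : ℂ) :
    DifferentiableOn ℂ (eulerIntegral a b) gaussCutPlane := by
  intro w₀ hw₀
  refine (DifferentiableAt.const_mul ?_ _).differentiableWithinAt
  have hI : IntervalIntegrable (fun t : ℝ => t ^ (a - 1)) volume 0 1 :=
    intervalIntegral.intervalIntegrable_rpow' (by linarith)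
  obtain ⟨r, hr, hball⟩ := Metric.nhds_basis_closedBall.mem_iff.1
    (isOpen_gaussCutPlane.mem_nhds hw₀)
  have hcont : ∀ d : ℂ, ContinuousOn (fun p : ℂ × ℝ => (1 - p.1 * p.2 : ℂ) ^ d)
      (Metric.closedBall w₀ r ×ˢ Set.Icc 0 1) := fun d => by
    refine ContinuousOn.cpow (by fun_prop) continuousOn_const fun p hp => ?_
    exact one_sub_mul_mem_slitPlane (hball hp.1) hp.2
  -- Compactness bounds the only factor of the `w`-derivative that depends on `w`, leaving the
  -- integrable majorant `t^(a-1) ‖b‖ C`.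
  obtain ⟨C, hC⟩ := ((isCompact_closedBall w₀ r).prod isCompact_Icc).exists_bound_of_continuousOn
    (hcont (-b - 1))
  have hint : IntervalIntegrable (fun t : ℝ => ((t ^ (a - 1) : ℝ) : ℂ) * (1 - w₀ * t) ^ (-b))
      volume 0 1 := by
    refine IntervalIntegrable.mul_continuousOn ⟨hI.1.ofReal, hI.2.ofReal⟩ ?_
    rw [Set.uIcc_of_le zero_le_one]
    exact (hcont (-b)).comp (f := fun t : ℝ => (w₀, t)) (by fun_prop)
      fun t ht => ⟨Metric.mem_closedBall_self hr.le, ht⟩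
  refine (intervalIntegral.hasDerivAt_integral_of_dominated_loc_of_deriv_le
    (μ := volume) (a := 0) (b := 1) (s := Metric.closedBall w₀ r)
    (F := fun (w : ℂ) (t : ℝ) => ((t ^ (a - 1) : ℝ) : ℂ) * (1 - w * t) ^ (-b))
    (F' := fun (w : ℂ) (t : ℝ) => ((t ^ (a - 1) : ℝ) : ℂ) *
      (-b * (1 - w * t) ^ (-b - 1) * -t))
    (bound := fun t => t ^ (a - 1) * (‖b‖ * C))
    (Metric.closedBall_mem_nhds w₀ hr)
    (Filter.Eventually.of_forall fun w => Measurable.aestronglyMeasurable (by fun_prop))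
    hint (Measurable.aestronglyMeasurable (by fun_prop)) ?_ (hI.mul_const _) ?_).2.differentiableAt
  · refine ae_of_all _ fun t ht w hw => ?_
    rw [Set.uIoc_of_le zero_le_one] at ht
    have ht0 : 0 ≤ t ^ (a - 1) := Real.rpow_nonneg ht.1.le _
    have hCb := hC (w, t) ⟨hw, ht.1.le, ht.2⟩
    rw [norm_mul, norm_mul, norm_mul, norm_neg, norm_neg, Complex.norm_real, Complex.norm_real,
      Real.norm_of_nonneg ht0, Real.norm_of_nonneg ht.1.le]
    refine mul_le_mul_of_nonneg_left ?_ ht0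
    refine (mul_le_of_le_one_right (by positivity) ht.2).trans ?_
    gcongr
  · refine ae_of_all _ fun t ht w hw => ?_
    rw [Set.uIoc_of_le zero_le_one] at ht
    refine HasDerivAt.const_mul _ ?_
    have h1 : HasDerivAt (fun w : ℂ => 1 - w * t) (-t) w := by
      simpa using ((hasDerivAt_id w).mul_const (t : ℂ)).const_sub 1
    exact h1.cpow_const (one_sub_mul_mem_slitPlane (hball hw) ⟨ht.1.le, ht.2⟩)

theorem isGaussContinuation_eulerIntegral {a : ℝ} (ha : 0 < a) (b : ℂ) :
    IsGaussContinuation a b (a + 1) (eulerIntegral a b) :=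
  ⟨differentiableOn_eulerIntegral ha b,
    fun _ hz => eulerIntegral_eq_ordinaryHypergeometric ha b hz⟩

theorem gaussHypergeometric_eq_eulerIntegral {a : ℝ} (ha : 0 < a) (b : ℂ) {w : ℂ}
    (hw : w ∈ gaussCutPlane) : gaussHypergeometric a b (a + 1) w = eulerIntegral a b w := by
  have hex : ∃ g : ℂ → ℂ, IsGaussContinuation a b (a + 1) g :=
    ⟨_, isGaussContinuation_eulerIntegral ha b⟩
  rw [gaussHypergeometric, dif_pos hex]
  exact hex.choose_spec.eqOn (isGaussContinuation_eulerIntegral ha b) hw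

/-- The substitution `y = x t` gives Euler's integral at `w = -x`, which lies in the cut plane even
when `x ≥ 1`. -/
theorem integral_betaPrimePDF_eq_gaussHypergeometric {m n x : ℝ} (hm : 0 < m) (hx : 0 < x) :
    ((∫ y in (0 : ℝ)..x, betaPrimePDF m n y : ℝ) : ℂ) =
      ((x ^ m / (m * beta m n) : ℝ) : ℂ) * gaussHypergeometric m (m + n) (m + 1) (-x) := by
  have hcut : (-x : ℂ) ∈ gaussCutPlane := by
    have : (1 - -x : ℂ) = ((1 + x : ℝ) : ℂ) := by push_cast; ring
    simp only [gaussCutPlane, Set.mem_ofPred_eq, this]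
    exact Complex.ofReal_mem_slitPlane.2 (by linarith)
  have hsub := intervalIntegral.smul_integral_comp_mul_left (a := 0) (b := 1)
    (betaPrimePDF m n) x
  rw [mul_zero, mul_one] at hsub
  have hcongr : ∫ t in (0 : ℝ)..1, betaPrimePDF m n (x * t) =
      ∫ t in (0 : ℝ)..1, (x ^ (m - 1) / beta m n) * (t ^ (m - 1) * (1 + x * t) ^ (-(m + n))) := by
    refine intervalIntegral.integral_congr_ae (ae_of_all _ fun t ht => ?_)
    rw [Set.uIoc_of_le zero_le_one] at ht
    rw [betaPrimePDF, Real.mul_rpow hx.le ht.1.le]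
    ring
  have hcast : ∫ t in (0 : ℝ)..1, ((t ^ (m - 1) : ℝ) : ℂ) * (1 - -x * t : ℂ) ^ (-(m + n : ℂ)) =
      ((∫ t in (0 : ℝ)..1, t ^ (m - 1) * (1 + x * t) ^ (-(m + n)) : ℝ) : ℂ) := by
    rw [← intervalIntegral.integral_ofReal]
    refine intervalIntegral.integral_congr_ae (ae_of_all _ fun t ht => ?_)
    rw [Set.uIoc_of_le zero_le_one] at ht
    have h1 : 0 ≤ 1 + x * t := by nlinarith [ht.1]
    rw [Complex.ofReal_mul, Complex.ofReal_cpow h1]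
    push_cast
    congr 2
    ring
  rw [gaussHypergeometric_eq_eulerIntegral hm _ hcut, eulerIntegral, hcast, ← hsub, hcongr,
    intervalIntegral.integral_const_mul, ← Complex.ofReal_mul, ← Complex.ofReal_mul, smul_eq_mul,
    Real.rpow_sub_one hx.ne']
  congr 1
  field_simp

/-! ### The minimum of two independent positive random variables with densities -/

theorem intervalIntegral_zero_eq_zero_of_nonpos {f : ℝ → ℝ} (hneg : ∀ x ≤ 0, f x = 0) {u : ℝ}
    (hu : u ≤ 0) : ∫ x in (0 : ℝ)..u, f x = 0 := by
  rw [intervalIntegral.integral_symm, intervalIntegral.integral_of_le hu,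
    setIntegral_congr_fun (g := fun _ => (0 : ℝ)) measurableSet_Ioc fun x hx => hneg x hx.2]
  simp

theorem withDensity_ofReal_Iic {f : ℝ → ℝ} (h0 : ∀ x, 0 ≤ f x) (hneg : ∀ x ≤ 0, f x = 0)
    (hint : ∀ u, IntervalIntegrable f volume 0 u) (u : ℝ) :
    volume.withDensity (fun x => ENNReal.ofReal (f x)) (Set.Iic u) =
      ENNReal.ofReal (∫ x in (0 : ℝ)..u, f x) := by
  rw [withDensity_apply _ measurableSet_Iic]
  rcases le_total u 0 with hu | hu
  · rw [intervalIntegral_zero_eq_zero_of_nonpos hneg hu,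
      setLIntegral_congr_fun (g := fun _ => 0) measurableSet_Iic fun x hx => ?_]
    · simp
    · simp [hneg x (le_trans hx hu)]
  · rw [← Set.Iic_union_Ioc_eq_Iic hu, lintegral_union measurableSet_Ioc
      (Set.Iic_disjoint_Ioc le_rfl), setLIntegral_congr_fun (g := fun _ => 0) measurableSet_Iic
      fun x hx => by simp [hneg x hx], intervalIntegral.integral_of_le hu,
      ofReal_integral_eq_lintegral_ofReal (hint u).1 (ae_of_all _ h0)]
    simp

theorem cdf_withDensity_ofReal {f : ℝ → ℝ} (h0 : ∀ x, 0 ≤ f x) (hneg : ∀ x ≤ 0, f x = 0)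
    (hint : ∀ u, IntervalIntegrable f volume 0 u)
    [IsProbabilityMeasure (volume.withDensity fun x => ENNReal.ofReal (f x))] (u : ℝ) :
    cdf (volume.withDensity fun x => ENNReal.ofReal (f x)) u = ∫ x in (0 : ℝ)..u, f x := by
  rw [cdf_eq_real, measureReal_def, withDensity_ofReal_Iic h0 hneg hint, ENNReal.toReal_ofReal]
  rcases le_total u 0 with hu | hu
  · exact (intervalIntegral_zero_eq_zero_of_nonpos hneg hu).ge
  · exact intervalIntegral.integral_nonneg hu fun x _ => h0 x

/-- The minimum exceeds `u` exactly when both variables do, so the survival functions multiply. -/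
theorem cdf_map_min {Ω : Type*} [MeasurableSpace Ω] {P : Measure Ω} [IsProbabilityMeasure P]
    {X Y : Ω → ℝ} (hX : AEMeasurable X P) (hY : AEMeasurable Y P) (h : IndepFun X Y P) (u : ℝ) :
    cdf (P.map fun ω => min (X ω) (Y ω)) u = cdf (P.map X) u + cdf (P.map Y) u -
      cdf (P.map X) u * cdf (P.map Y) u := by
  have hZ : AEMeasurable (fun ω => min (X ω) (Y ω)) P := hX.min hY
  have := Measure.isProbabilityMeasure_map hX
  have := Measure.isProbabilityMeasure_map hY
  have := Measure.isProbabilityMeasure_map hZ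
  have hcompl : ∀ μ : Measure ℝ, IsProbabilityMeasure μ →
      cdf μ u = 1 - μ.real (Set.Ioi u) := fun μ _ => by
    rw [cdf_eq_real, ← Set.compl_Ioi, probReal_compl_eq_one_sub measurableSet_Ioi]
  have hmul : (P.map fun ω => min (X ω) (Y ω)).real (Set.Ioi u) =
      (P.map X).real (Set.Ioi u) * (P.map Y).real (Set.Ioi u) := by
    rw [map_measureReal_apply_of_aemeasurable hX measurableSet_Ioi,
      map_measureReal_apply_of_aemeasurable hY measurableSet_Ioi,
      map_measureReal_apply_of_aemeasurable hZ measurableSet_Ioi, measureReal_def, measureReal_def,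
      measureReal_def, ← ENNReal.toReal_mul, ← h.measure_inter_preimage_eq_mul _ _
        measurableSet_Ioi measurableSet_Ioi]
    congr 2
    ext ω
    simp
  rw [hcompl _ inferInstance, hcompl _ inferInstance, hcompl _ inferInstance, hmul]
  ring

/-- Continuity is asked only on `(0,∞)`, since the densities may blow up at `0`. -/
theorem cdf_and_density_of_min {Ω : Type*} [MeasurableSpace Ω] {P : Measure Ω}
    [IsProbabilityMeasure P] {X Y : Ω → ℝ} {f g : ℝ → ℝ}
    (hX : HasLaw X (volume.withDensity fun x => ENNReal.ofReal (f x)) P)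
    (hY : HasLaw Y (volume.withDensity fun x => ENNReal.ofReal (g x)) P) (hXY : IndepFun X Y P)
    (hfm : Measurable f) (hgm : Measurable g) (hf0 : ∀ x, 0 ≤ f x) (hg0 : ∀ x, 0 ≤ g x)
    (hfneg : ∀ x ≤ 0, f x = 0) (hgneg : ∀ x ≤ 0, g x = 0)
    (hfint : ∀ u, IntervalIntegrable f volume 0 u) (hgint : ∀ u, IntervalIntegrable g volume 0 u)
    (hfc : ∀ x, 0 < x → ContinuousAt f x) (hgc : ∀ x, 0 < x → ContinuousAt g x) :
    (∀ u, cdf (P.map fun ω => min (X ω) (Y ω)) u =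
      (∫ x in (0 : ℝ)..u, f x) + (∫ x in (0 : ℝ)..u, g x) -
        (∫ x in (0 : ℝ)..u, f x) * ∫ x in (0 : ℝ)..u, g x) ∧
    (∀ u ≤ 0, cdf (P.map fun ω => min (X ω) (Y ω)) u = 0) ∧
    ∃ h : ℝ → ℝ, Measurable h ∧ (∀ z, 0 ≤ h z) ∧ (∀ z ≤ 0, h z = 0) ∧
      (P.map fun ω => min (X ω) (Y ω)) = volume.withDensity (fun z => ENNReal.ofReal (h z)) ∧
      ∀ z, 0 < z →
        HasDerivAt (fun u => cdf (P.map fun ω => min (X ω) (Y ω)) u) (h z) z ∧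
        h z = f z * (1 - ∫ x in (0 : ℝ)..z, g x) + g z * (1 - ∫ x in (0 : ℝ)..z, f x) := by
  -- The total mass is inherited from the law of `X`; no normalising integral is computed.
  have hPX : IsProbabilityMeasure (volume.withDensity fun x => ENNReal.ofReal (f x)) :=
    hX.map_eq ▸ Measure.isProbabilityMeasure_map hX.aemeasurable
  have hPY : IsProbabilityMeasure (volume.withDensity fun x => ENNReal.ofReal (g x)) :=
    hY.map_eq ▸ Measure.isProbabilityMeasure_map hY.aemeasurable
  have hcf := cdf_withDensity_ofReal hf0 hfneg hfint
  have hcg := cdf_withDensity_ofReal hg0 hgneg hgint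
  set F : ℝ → ℝ := fun u => ∫ x in (0 : ℝ)..u, f x with hF
  set G : ℝ → ℝ := fun u => ∫ x in (0 : ℝ)..u, g x with hG
  have hFG : ∀ u, cdf (P.map fun ω => min (X ω) (Y ω)) u = F u + G u - F u * G u := fun u => by
    rw [cdf_map_min hX.aemeasurable hY.aemeasurable hXY, hX.map_eq, hY.map_eq, hcf, hcg]
  have hF1 : ∀ u, F u ≤ 1 := fun u => (hcf u).symm.trans_le (cdf_le_one _ u)
  have hG1 : ∀ u, G u ≤ 1 := fun u => (hcg u).symm.trans_le (cdf_le_one _ u)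
  have hFnn : ∀ u, 0 ≤ F u := fun u => (cdf_nonneg _ u).trans_eq (hcf u)
  have hGnn : ∀ u, 0 ≤ G u := fun u => (cdf_nonneg _ u).trans_eq (hcg u)
  have hFcont : Continuous F := intervalIntegral.continuous_primitive
    (fun a b => (hfint a).symm.trans (hfint b)) 0
  have hGcont : Continuous G := intervalIntegral.continuous_primitive
    (fun a b => (hgint a).symm.trans (hgint b)) 0
  set h : ℝ → ℝ := fun z => f z * (1 - G z) + g z * (1 - F z) with hh
  have hhm : Measurable h := (hfm.mul (hGcont.measurable.const_sub 1)).add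
    (hgm.mul (hFcont.measurable.const_sub 1))
  have hh0 : ∀ z, 0 ≤ h z := fun z => add_nonneg
    (mul_nonneg (hf0 z) (sub_nonneg.2 (hG1 z))) (mul_nonneg (hg0 z) (sub_nonneg.2 (hF1 z)))
  have hhneg : ∀ z ≤ 0, h z = 0 := fun z hz => by simp [hh, hfneg z hz, hgneg z hz]
  have hhint : ∀ u, IntervalIntegrable h volume 0 u := fun u => by
    refine ((hfint u).add (hgint u)).mono_fun hhm.aestronglyMeasurable (ae_of_all _ fun z => ?_)
    change ‖h z‖ ≤ ‖f z + g z‖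
    rw [Real.norm_of_nonneg (hh0 z),
      Real.norm_of_nonneg (add_nonneg (hf0 z) (hg0 z))]
    exact add_le_add (mul_le_of_le_one_right (hf0 z) (by linarith [hGnn z]))
      (mul_le_of_le_one_right (hg0 z) (by linarith [hFnn z]))
  have hderiv : ∀ z, 0 < z → HasDerivAt (fun u => F u + G u - F u * G u) (h z) z := fun z hz => by
    have hFd : HasDerivAt F (f z) z := intervalIntegral.integral_hasDerivAt_right (hfint z)
      hfm.stronglyMeasurable.stronglyMeasurableAtFilter (hfc z hz)
    have hGd : HasDerivAt G (g z) z := intervalIntegral.integral_hasDerivAt_right (hgint z)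
      hgm.stronglyMeasurable.stronglyMeasurableAtFilter (hgc z hz)
    refine ((hFd.add hGd).sub (hFd.mul hGd)).congr_deriv ?_
    simp only [hh]
    ring
  have hzero : ∀ u ≤ 0, F u + G u - F u * G u = 0 := fun u hu => by
    simp [hF, hG, intervalIntegral_zero_eq_zero_of_nonpos hfneg hu,
      intervalIntegral_zero_eq_zero_of_nonpos hgneg hu]
  refine ⟨hFG, fun u hu => by rw [hFG, hzero u hu], h, hhm, hh0, hhneg, ?_,
    fun z hz => ⟨(hderiv z hz).congr_of_eventuallyEq (Filter.Eventually.of_forall hFG), rfl⟩⟩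
  have hPZ : IsProbabilityMeasure (P.map fun ω => min (X ω) (Y ω)) :=
    Measure.isProbabilityMeasure_map (hX.aemeasurable.min hY.aemeasurable)
  -- Both measures are compared on half-lines. The fundamental theorem of calculus needs the
  -- derivative only inside `(0,u)`, with continuity of the primitives at the ends.
  refine Measure.ext_of_Iic _ _ fun u => ?_
  rw [← ofReal_cdf, hFG, withDensity_ofReal_Iic hh0 hhneg hhint]
  congr 1
  rcases le_total u 0 with hu | hu
  · rw [hzero u hu, intervalIntegral_zero_eq_zero_of_nonpos hhneg hu]
  · rw [intervalIntegral.integral_eq_sub_of_hasDerivAt_of_le hu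
      ((hFcont.add hGcont).sub (hFcont.mul hGcont)).continuousOn
      (fun z hz => hderiv z hz.1) (hhint u)]
    exact (sub_eq_self.2 (hzero 0 le_rfl)).symm

/-! ### The Fisher–Snedecor density -/

theorem fsScale_pos {m ms γ : ℝ} (hm : 0 < m) (hms : 1 < ms) (hγ : 0 < γ) :
    0 < fsScale m ms γ := div_pos hm (mul_pos (by linarith) hγ)

theorem mul_betaPrimePDF_mul {m n l x : ℝ} (hl : 0 < l) (hx : 0 < x) :
    l * betaPrimePDF m n (l * x) =
      l ^ m * x ^ (m - 1) * (1 + l * x) ^ (-(m + n)) / beta m n := by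
  rw [betaPrimePDF, Real.mul_rpow hl.le hx.le, Real.rpow_sub_one hl.ne']
  field_simp

/-- With `k = (ms-1)γ`, the denominator's base is `k (1 + Λ x)`. Of `k^(m+ms)`, the part `k^ms`
cancels the numerator and `k^m` turns `m^m` into `Λ^m`. -/
theorem fisherSnedecorPDF_of_pos {m ms γ x : ℝ} (hm : 0 < m) (hms : 1 < ms) (hγ : 0 < γ)
    (hx : 0 < x) : fisherSnedecorPDF m ms γ x =
      fsScale m ms γ * betaPrimePDF m ms (fsScale m ms γ * x) := by
  have hms' : 0 < ms - 1 := by linarith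
  have hk : 0 < (ms - 1) * γ := mul_pos hms' hγ
  have e : m * x + (ms - 1) * γ = ((ms - 1) * γ) * (1 + fsScale m ms γ * x) := by
    rw [fsScale]
    field_simp
    ring
  have h1 : 0 < 1 + fsScale m ms γ * x := by
    have := mul_pos (fsScale_pos hm hms hγ) hx
    linarith
  have hb : beta m ms ≠ 0 := (beta_pos hm (by linarith)).ne'
  rw [fisherSnedecorPDF, if_pos hx, mul_betaPrimePDF_mul (fsScale_pos hm hms hγ) hx, e,
    Real.mul_rpow hk.le h1.le, Real.rpow_neg h1.le, Real.rpow_add hk, fsScale,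
    Real.div_rpow hm.le hk.le, Real.mul_rpow hms'.le hγ.le (z := ms)]
  have p1 := Real.rpow_pos_of_pos hms' ms
  have p2 := Real.rpow_pos_of_pos hγ ms
  have p3 := Real.rpow_pos_of_pos hk m
  have p4 := Real.rpow_pos_of_pos h1 (m + ms)
  rw [fsScale] at p4
  field_simp

theorem fisherSnedecorPDF_of_nonpos (m ms γ : ℝ) {x : ℝ} (hx : x ≤ 0) :
    fisherSnedecorPDF m ms γ x = 0 := if_neg hx.not_gt

theorem fisherSnedecorPDF_nonneg {m ms γ : ℝ} (hm : 0 < m) (hms : 1 < ms) (hγ : 0 < γ) (x : ℝ) :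
    0 ≤ fisherSnedecorPDF m ms γ x := by
  rcases le_or_gt x 0 with hx | hx
  · rw [fisherSnedecorPDF_of_nonpos m ms γ hx]
  · have hl := fsScale_pos hm hms hγ
    have := beta_pos hm (zero_lt_one.trans hms)
    rw [fisherSnedecorPDF_of_pos hm hms hγ hx, mul_betaPrimePDF_mul hl hx]
    positivity

theorem measurable_fisherSnedecorPDF (m ms γ : ℝ) : Measurable (fisherSnedecorPDF m ms γ) :=
  Measurable.ite measurableSet_Ioi (by fun_prop) measurable_const

theorem continuousAt_fisherSnedecorPDF {m ms γ x : ℝ} (hm : 0 < m) (hms : 1 < ms) (hγ : 0 < γ)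
    (hx : 0 < x) : ContinuousAt (fisherSnedecorPDF m ms γ) x := by
  have hl := fsScale_pos hm hms hγ
  have h1 : 1 + fsScale m ms γ * x ≠ 0 := by positivity
  have : ContinuousAt (fun x => fsScale m ms γ ^ m * x ^ (m - 1) *
      (1 + fsScale m ms γ * x) ^ (-(m + ms)) / beta m ms) x := by
    refine ((continuousAt_const.mul (Real.continuousAt_rpow_const _ _ (Or.inl hx.ne'))).mul
      (ContinuousAt.rpow_const (by fun_prop) (Or.inl h1))).div_const _
  refine this.congr ?_
  filter_upwards [lt_mem_nhds hx] with y hy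
  rw [fisherSnedecorPDF_of_pos hm hms hγ hy, mul_betaPrimePDF_mul hl hy]

theorem intervalIntegrable_fisherSnedecorPDF {m ms γ : ℝ} (hm : 0 < m) (hms : 1 < ms)
    (hγ : 0 < γ) (u : ℝ) : IntervalIntegrable (fisherSnedecorPDF m ms γ) volume 0 u := by
  have hl := fsScale_pos hm hms hγ
  have hb := beta_pos hm (zero_lt_one.trans hms)
  have hI : IntervalIntegrable (fun x : ℝ => x ^ (m - 1)) volume 0 u :=
    intervalIntegral.intervalIntegrable_rpow' (by linarith)
  -- The factor `(1 + Λ x)^(-(m+ms)) ≤ 1` is dropped; `x^(m-1)` is integrable at `0` because `m >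
  -- 0`.
  refine (hI.const_mul (fsScale m ms γ ^ m / beta m ms)).mono_fun
    (measurable_fisherSnedecorPDF m ms γ).aestronglyMeasurable (ae_of_all _ fun x => ?_)
  simp only
  rcases le_or_gt x 0 with hx | hx
  · simp only [fisherSnedecorPDF_of_nonpos m ms γ hx, norm_zero, norm_nonneg]
  · rw [Real.norm_of_nonneg (fisherSnedecorPDF_nonneg hm hms hγ x),
      fisherSnedecorPDF_of_pos hm hms hγ hx, mul_betaPrimePDF_mul hl hx,
      Real.norm_of_nonneg (by positivity), div_mul_eq_mul_div]
    refine div_le_div_of_nonneg_right (mul_le_of_le_one_right (by positivity) ?_) hb.le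
    exact Real.rpow_le_one_of_one_le_of_nonpos (by nlinarith [mul_pos hl hx]) (by linarith)

theorem integral_fisherSnedecorPDF {m ms γ u : ℝ} (hm : 0 < m) (hms : 1 < ms)
    (hγ : 0 < γ) (hu : 0 < u) : ∫ x in (0 : ℝ)..u, fisherSnedecorPDF m ms γ x =
      ∫ y in (0 : ℝ)..fsScale m ms γ * u, betaPrimePDF m ms y := by
  have h := intervalIntegral.smul_integral_comp_mul_left (a := 0) (b := u)
    (betaPrimePDF m ms) (fsScale m ms γ)
  rw [mul_zero, smul_eq_mul, ← intervalIntegral.integral_const_mul] at h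
  rw [← h]
  refine intervalIntegral.integral_congr_ae (ae_of_all _ fun x hx => ?_)
  rw [Set.uIoc_of_le hu.le] at hx
  exact fisherSnedecorPDF_of_pos hm hms hγ hx.1

theorem fsTheta_mul_fsG22_eq_integral {m ms γ u : ℝ} (hm : 0 < m) (hms : 1 < ms) (hγ : 0 < γ)
    (hu : 0 < u) : (fsTheta m ms : ℂ) * fsG22 m ms (fsScale m ms γ * u) =
      ((∫ x in (0 : ℝ)..u, fisherSnedecorPDF m ms γ x : ℝ) : ℂ) := by
  rw [integral_fisherSnedecorPDF hm hms hγ hu, ← Complex.ofReal_mul,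
    fsTheta_mul_fsG22 hm (by linarith) (mul_pos (fsScale_pos hm hms hγ) hu)]

theorem fsScale_mul_fsTheta_mul_fsG33 {m ms γ z : ℝ} (hm : 0 < m) (hms : 1 < ms) (hγ : 0 < γ)
    (hz : 0 < z) : (fsScale m ms γ : ℂ) * fsTheta m ms * fsG33 m ms (fsScale m ms γ * z) =
      (fisherSnedecorPDF m ms γ z : ℂ) := by
  rw [fisherSnedecorPDF_of_pos hm hms hγ hz, mul_assoc, ← Complex.ofReal_mul,
    fsTheta_mul_fsG33 hm (by linarith) (mul_pos (fsScale_pos hm hms hγ) hz), ← Complex.ofReal_mul]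

theorem integral_fisherSnedecorPDF_eq_gaussHypergeometric {m ms γ z : ℝ} (hm : 0 < m)
    (hms : 1 < ms) (hγ : 0 < γ) (hz : 0 < z) :
    ((fsScale m ms γ ^ m * z ^ m / (m * beta m ms) : ℝ) : ℂ) *
        gaussHypergeometric m (m + ms) (m + 1) (-(fsScale m ms γ * z)) =
      ((∫ x in (0 : ℝ)..z, fisherSnedecorPDF m ms γ x : ℝ) : ℂ) := by
  have hl := fsScale_pos hm hms hγ
  rw [integral_fisherSnedecorPDF hm hms hγ hz,
    integral_betaPrimePDF_eq_gaussHypergeometric hm (mul_pos hl hz), Real.mul_rpow hl.le hz.le,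
    Complex.ofReal_mul (fsScale m ms γ) z]

theorem mainTheorem5 {Ω : Type*} [MeasurableSpace Ω] (P : Measure Ω) [IsProbabilityMeasure P]
    (m ms γ : Fin 2 → ℝ) (hm : ∀ i, 0 < m i) (hms : ∀ i, 1 < ms i) (hγ : ∀ i, 0 < γ i)
    (X : Fin 2 → Ω → ℝ)
    (hX : ∀ i, HasLaw (X i) (fisherSnedecor (m i) (ms i) (γ i)) P)
    (hindep : IndepFun (X 0) (X 1) P)
    (Z : Ω → ℝ) (hZ : Z = fun ω => min (X 0 ω) (X 1 ω))
    (Λ Θ : Fin 2 → ℝ) (hΛ : ∀ i, Λ i = fsScale (m i) (ms i) (γ i))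
    (hΘ : ∀ i, Θ i = fsTheta (m i) (ms i)) :
    (∀ u : ℝ, u ≤ 0 → cdf (P.map Z) u = 0) ∧
    (∀ u : ℝ, 0 < u →
      ((cdf (P.map Z) u : ℝ) : ℂ) =
        ∑ i, (Θ i : ℂ) * fsG22 (m i) (ms i) (Λ i * u)
          - ∏ i, (Θ i : ℂ) * fsG22 (m i) (ms i) (Λ i * u)) ∧
    ∃ f : ℝ → ℝ, Measurable f ∧ (∀ z, 0 ≤ f z) ∧ (∀ z : ℝ, z ≤ 0 → f z = 0) ∧
      P.map Z = volume.withDensity (fun z => ENNReal.ofReal (f z)) ∧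
      ∀ z : ℝ, 0 < z →
        HasDerivAt (fun u : ℝ => cdf (P.map Z) u) (f z) z ∧
        (f z : ℂ) =
          ∑ i, (Λ i : ℂ) * Θ i * fsG33 (m i) (ms i) (Λ i * z)
            - ∑ i, ∑ l ∈ Finset.univ.erase i,
                ((Λ l : ℂ) * Θ l * fsG33 (m l) (ms l) (Λ l * z)) *
                  ((Θ i : ℂ) * fsG22 (m i) (ms i) (Λ i * z)) ∧
        (f z : ℂ) =
          ∑ i, ((Λ i ^ m i * z ^ (m i - 1) * (1 + Λ i * z) ^ (-(m i + ms i))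
                / beta (m i) (ms i) : ℝ) : ℂ)
            - ∑ i, ∑ l ∈ Finset.univ.erase i,
                ((Λ l ^ m l * z ^ (m l - 1) * (1 + Λ l * z) ^ (-(m l + ms l))
                    / beta (m l) (ms l) : ℝ) : ℂ) *
                  (((Λ i ^ m i * z ^ m i / (m i * beta (m i) (ms i)) : ℝ) : ℂ) *
                    gaussHypergeometric (m i) (m i + ms i) (m i + 1) (-(Λ i * z))) := by
  subst hZ
  obtain rfl : Λ = fun i => fsScale (m i) (ms i) (γ i) := funext hΛ
  obtain rfl : Θ = fun i => fsTheta (m i) (ms i) := funext hΘ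
  obtain ⟨hcdf, hcdf0, f, hfm, hf0, hfneg, hlaw, hf⟩ := cdf_and_density_of_min (hX 0) (hX 1) hindep
    (measurable_fisherSnedecorPDF _ _ _) (measurable_fisherSnedecorPDF _ _ _)
    (fisherSnedecorPDF_nonneg (hm 0) (hms 0) (hγ 0))
    (fisherSnedecorPDF_nonneg (hm 1) (hms 1) (hγ 1))
    (fun _ => fisherSnedecorPDF_of_nonpos _ _ _) (fun _ => fisherSnedecorPDF_of_nonpos _ _ _)
    (intervalIntegrable_fisherSnedecorPDF (hm 0) (hms 0) (hγ 0))
    (intervalIntegrable_fisherSnedecorPDF (hm 1) (hms 1) (hγ 1))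
    (fun _ => continuousAt_fisherSnedecorPDF (hm 0) (hms 0) (hγ 0))
    (fun _ => continuousAt_fisherSnedecorPDF (hm 1) (hms 1) (hγ 1))
  -- For two indices the double sum over `i ≠ l` consists of the two cross terms `f₁ F₀` and `f₀
  -- F₁`.
  have e0 : (Finset.univ : Finset (Fin 2)).erase 0 = {1} := by decide
  have e1 : (Finset.univ : Finset (Fin 2)).erase 1 = {0} := by decide
  refine ⟨hcdf0, fun u hu => ?_, f, hfm, hf0, hfneg, hlaw, fun z hz => ⟨(hf z hz).1, ?_, ?_⟩⟩
  · simp only [fsTheta_mul_fsG22_eq_integral (hm _) (hms _) (hγ _) hu, Fin.sum_univ_two,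
      Fin.prod_univ_two]
    rw [hcdf]
    push_cast
    ring
  · simp only [fsTheta_mul_fsG22_eq_integral (hm _) (hms _) (hγ _) hz,
      fsScale_mul_fsTheta_mul_fsG33 (hm _) (hms _) (hγ _) hz, Fin.sum_univ_two, e0, e1,
      Finset.sum_singleton]
    rw [(hf z hz).2]
    push_cast
    ring
  · have hpdf : ∀ i, fsScale (m i) (ms i) (γ i) ^ m i * z ^ (m i - 1) *
        (1 + fsScale (m i) (ms i) (γ i) * z) ^ (-(m i + ms i)) / beta (m i) (ms i) =
        fisherSnedecorPDF (m i) (ms i) (γ i) z := fun i => by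
      rw [fisherSnedecorPDF_of_pos (hm i) (hms i) (hγ i) hz,
        mul_betaPrimePDF_mul (fsScale_pos (hm i) (hms i) (hγ i)) hz]
    simp only [hpdf, integral_fisherSnedecorPDF_eq_gaussHypergeometric (hm _) (hms _) (hγ _) hz,
      Fin.sum_univ_two, e0, e1, Finset.sum_singleton]
    rw [(hf z hz).2]
    push_cast
    ring
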